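/- Let $m\ge 0$, let $K$ be an abstract simplicial complex on $[m]=\{1,\dots,m\}$ containing all singletons $\{i\}$, and let $$RC_K=\langle g_1,\dots,g_m \mid g_i^2=1 \text{ for all } i,\ \ g_ig_j=g_jg_i \text{ whenever } \{i,j\}\in K\rangle$$ be the corresponding right-angled Coxeter group. For a group $G$ put $(a,b)=a^{-1}b^{-1}ab$, let $\gamma_1(G)=G$ and let $\gamma_{k+1}(G)=(\gamma_k(G),G)$ be the subgroup generated by all $(a,b)$ with $a\in\gamma_k(G)$, $b\in G$. Let $L(G)=\bigoplus_{k\ge1}L^k(G)$, $L^k(G)=\gamma_k(G)/\gamma_{k+1}(G)$, be the Lie ring with bracket induced by $[\overline{a},\overline{b}]=\overline{(a,b)}\in L^{k+l}(G)$ for $a\in\gamma_k(G)$, $b\in\gamma_l(G)$, where $\overline a$ denotes the class of $a$ in $L^k(G)$. The groups $L^k(RC_K)$ are vector spaces over the field $\mathbb Z_2$ of two elements. Write $\overline g_i\in L^1(RC_K)$ for the class of $g_i$, $[x,y,z]=[[x,y],z]$, and $K_J=\{I\in K : I\subset J\}$ for $J\subset[m]$. Then: (a) $L^1(RC_K)$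 has the $\mathbb Z_2$-basis $\overline g_1,\dots,\overline g_m$; (b) $L^2(RC_K)$ has the $\mathbb Z_2$-basis consisting of the $[\overline g_i,\overline g_j]$ with $i<j$ and $\{i,j\}\notin K$; (c) $L^3(RC_K)$ has the $\mathbb Z_2$-basis consisting of the $[\overline g_i,\overline g_j,\overline g_j]$ with $i<j$ and $\{i,j\}\notin K$, together with the $[\overline g_i,\overline g_j,\overline g_k]$ with $i<j>k$, $i\ne k$, such that $i$ is the smallest vertex of a connected component of $K_{\{i,j,k\}}$ not containing $j$. In each case the listed elements, indexed by the tuples shown, are pairwise distinct. -/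

import Mathlib

open scoped DirectSum

namespace AssocLie

section General

universe u

variable {G : Type u} [Group G]

/-- The commutator `(a, b) = a⁻¹ b⁻¹ a b`. (Mathlib's `⁅a, b⁆` is `a b a⁻¹ b⁻¹`.) -/
def comm (a b : G) : G := a⁻¹ * b⁻¹ * a * b

variable (G) in
/-- The lower central series `γ_1(G) = G`, `γ_{k+1}(G) = (γ_k(G), G)`, indexed from `1`.
Mathlib's series is indexed from `0`. -/
def gam (k : ℕ+) : Subgroup G := (⊤ : Subgroup G).lowerCentralSeries k.natPred

theorem gam_one : gam G 1 = ⊤ := rfl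

theorem gam_succ (k : ℕ+) : gam G (k + 1) = ⁅gam G k, (⊤ : Subgroup G)⁆ := by
  have h : (k + 1).natPred = k.natPred + 1 := by
    have := k.natPred_add_one
    have := (k + 1).natPred_add_one
    simp only [PNat.add_coe, PNat.one_coe] at this
    omega
  rw [gam, h]; rfl

instance gam_normal (k : ℕ+) : (gam G k).Normal := by
  unfold gam; infer_instance

theorem gam_succ_le (k : ℕ+) : gam G (k + 1) ≤ gam G k := by
  rw [gam_succ]; exact Subgroup.commutator_le_left _ _

theorem comm_mem {H K : Subgroup G} {a b : G} (ha : a ∈ H) (hb : b ∈ K) : comm a b ∈ ⁅H, K⁆ := by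
  have := Subgroup.commutator_mem_commutator (H.inv_mem ha) (K.inv_mem hb)
  simpa [comm, commutatorElement_def] using this

theorem commutator_le_of_rotate {A B C N : Subgroup G} [N.Normal]
    (h1 : ⁅⁅B, C⁆, A⁆ ≤ N) (h2 : ⁅⁅C, A⁆, B⁆ ≤ N) : ⁅⁅A, B⁆, C⁆ ≤ N := by
  have key : ∀ X Y Z : Subgroup G, ⁅⁅X, Y⁆, Z⁆ ≤ N ↔
      ⁅⁅X.map (QuotientGroup.mk' N), Y.map (QuotientGroup.mk' N)⁆,
        Z.map (QuotientGroup.mk' N)⁆ = ⊥ := by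
    intro X Y Z
    rw [← Subgroup.map_commutator, ← Subgroup.map_commutator, Subgroup.map_eq_bot_iff,
      QuotientGroup.ker_mk']
  rw [key] at h1 h2 ⊢
  exact Subgroup.commutator_commutator_eq_bot_of_rotate h1 h2

theorem commutator_gam_le (k l : ℕ+) : ⁅gam G k, gam G l⁆ ≤ gam G (k + l) := by
  induction l using PNat.recOn generalizing k with
  | one => rw [gam_succ]; rfl
  | succ l ih =>
    rw [gam_succ l, Subgroup.commutator_comm]
    refine commutator_le_of_rotate ?_ ?_
    · rw [Subgroup.commutator_comm ⊤, ← gam_succ]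
      have := ih (k + 1)
      rwa [add_assoc, add_comm 1 l] at this
    · rw [← add_assoc, gam_succ (k + l)]
      exact Subgroup.commutator_mono (ih k) le_rfl

theorem comm_mem_gam {k l : ℕ+} {a b : G} (ha : a ∈ gam G k) (hb : b ∈ gam G l) :
    comm a b ∈ gam G (k + l) := commutator_gam_le k l (comm_mem ha hb)

variable (G) in
/-- The graded component `L^k(G) = γ_k(G) / γ_{k+1}(G)`, written additively. -/
def Comp (k : ℕ+) : Type u := Additive (gam G k ⧸ (gam G (k + 1)).subgroupOf (gam G k))

instance (k : ℕ+) : AddGroup (Comp G k) :=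
  inferInstanceAs (AddGroup (Additive (gam G k ⧸ (gam G (k + 1)).subgroupOf (gam G k))))

/-- The class in `L^k(G)` of an element of `γ_k(G)`. -/
def cls (k : ℕ+) (x : G) (hx : x ∈ gam G k) : Comp G k :=
  Additive.ofMul (QuotientGroup.mk (⟨x, hx⟩ : gam G k))

theorem cls_surj {k : ℕ+} (X : Comp G k) : ∃ x hx, cls k x hx = X := by
  obtain ⟨⟨x, hx⟩, h⟩ := QuotientGroup.mk_surjective (Additive.toMul X)
  exact ⟨x, hx, congrArg Additive.ofMul h⟩

theorem cls_eq_iff {k : ℕ+} {x y : G} (hx : x ∈ gam G k) (hy : y ∈ gam G k) :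
    cls k x hx = cls k y hy ↔ (x : G ⧸ gam G (k + 1)) = (y : G ⧸ gam G (k + 1)) := by
  rw [QuotientGroup.eq]
  exact QuotientGroup.eq.trans Subgroup.mem_subgroupOf

theorem cls_mul {k : ℕ+} {x y : G} (hx : x ∈ gam G k) (hy : y ∈ gam G k) :
    cls k (x * y) (mul_mem hx hy) = cls k x hx + cls k y hy := rfl

theorem cls_inv {k : ℕ+} {x : G} (hx : x ∈ gam G k) :
    cls k x⁻¹ (inv_mem hx) = - cls k x hx := rfl

theorem cls_eq_zero_iff {k : ℕ+} {x : G} (hx : x ∈ gam G k) :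
    cls k x hx = 0 ↔ x ∈ gam G (k + 1) := by
  rw [← QuotientGroup.eq_one_iff]
  exact cls_eq_iff hx (one_mem _)

theorem quot_commute {k : ℕ+} {x : G} (hx : x ∈ gam G k) (g : G) :
    (x : G ⧸ gam G (k + 1)) * (g : G ⧸ gam G (k + 1)) =
      (g : G ⧸ gam G (k + 1)) * (x : G ⧸ gam G (k + 1)) := by
  have h := comm_mem hx (Subgroup.mem_top g)
  rw [← gam_succ, ← QuotientGroup.eq_one_iff] at h
  simp only [comm, QuotientGroup.mk_mul, QuotientGroup.mk_inv] at h
  rw [mul_assoc, mul_assoc] at h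
  generalize (x : G ⧸ gam G (k + 1)) = X at *
  generalize (g : G ⧸ gam G (k + 1)) = Y at *
  rw [inv_mul_eq_iff_eq_mul, inv_mul_eq_iff_eq_mul, mul_one] at h
  exact h

theorem nsmul_neg_aux {A : Type*} [AddGroup A] (X : A) :
    (2 : ℕ) • (-X) = -((2 : ℕ) • X) := by
  rw [two_nsmul, two_nsmul, neg_add_rev]

theorem cls_conj {k : ℕ+} {x : G} (hx : x ∈ gam G k) (g : G) (h : g⁻¹ * x * g ∈ gam G k) :
    cls k (g⁻¹ * x * g) h = cls k x hx := by
  rw [cls_eq_iff, QuotientGroup.mk_mul, QuotientGroup.mk_mul, mul_assoc, quot_commute hx,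
    ← mul_assoc, QuotientGroup.mk_inv, inv_mul_cancel, one_mul]

instance (k : ℕ+) : AddCommGroup (Comp G k) where
  add_comm X Y := by
    obtain ⟨x, hx, rfl⟩ := cls_surj X
    obtain ⟨y, hy, rfl⟩ := cls_surj Y
    rw [← cls_mul, ← cls_mul, cls_eq_iff]
    exact quot_commute hx y

theorem cls_congr {k : ℕ+} {x y : G} (h : x = y) (hx : x ∈ gam G k) :
    cls k x hx = cls k y (h ▸ hx) := by subst h; rfl

theorem conj_mem {k : ℕ+} {x : G} (hx : x ∈ gam G k) (g : G) : g⁻¹ * x * g ∈ gam G k := by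
  simpa using (gam_normal k).conj_mem x hx g⁻¹

theorem cls_comm_mul_left {k l : ℕ+} {a a' b : G} (ha : a ∈ gam G k) (ha' : a' ∈ gam G k)
    (hb : b ∈ gam G l) :
    cls (k + l) (comm (a * a') b) (comm_mem_gam (mul_mem ha ha') hb) =
      cls (k + l) (comm a b) (comm_mem_gam ha hb) +
        cls (k + l) (comm a' b) (comm_mem_gam ha' hb) := by
  have h : comm (a * a') b = (a'⁻¹ * comm a b * a') * comm a' b := by simp only [comm]; group
  rw [cls_congr h, cls_mul (conj_mem (comm_mem_gam ha hb) a') (comm_mem_gam ha' hb), cls_conj]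

theorem cls_comm_mul_right {k l : ℕ+} {a b b' : G} (ha : a ∈ gam G k) (hb : b ∈ gam G l)
    (hb' : b' ∈ gam G l) :
    cls (k + l) (comm a (b * b')) (comm_mem_gam ha (mul_mem hb hb')) =
      cls (k + l) (comm a b) (comm_mem_gam ha hb) +
        cls (k + l) (comm a b') (comm_mem_gam ha hb') := by
  have h : comm a (b * b') = comm a b' * (b'⁻¹ * comm a b * b') := by simp only [comm]; group
  rw [cls_congr h, cls_mul (comm_mem_gam ha hb') (conj_mem (comm_mem_gam ha hb) b'),
    cls_conj (comm_mem_gam ha hb)]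
  exact add_comm _ _

/-- For fixed `a ∈ γ_k(G)`, the map `L^l(G) → L^{k+l}(G)` sending the class of `b` to the class
of `(a, b)`. -/
def brRight (k l : ℕ+) (a : G) (ha : a ∈ gam G k) : Comp G l →+ Comp G (k + l) :=
  MonoidHom.toAdditive <| QuotientGroup.lift ((gam G (l + 1)).subgroupOf (gam G l))
    (MonoidHom.mk' (fun b : gam G l =>
        (Additive.toMul (cls (k + l) (comm a b) (comm_mem_gam ha b.2)) :
          gam G (k + l) ⧸ (gam G (k + l + 1)).subgroupOf (gam G (k + l))))
      (fun b b' => cls_comm_mul_right ha b.2 b'.2))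
    (fun b hb => (cls_eq_zero_iff _).2 (by
      have := comm_mem_gam ha (Subgroup.mem_subgroupOf.1 hb)
      rwa [← add_assoc] at this))

theorem brRight_cls {k l : ℕ+} {a b : G} (ha : a ∈ gam G k) (hb : b ∈ gam G l) :
    brRight k l a ha (cls l b hb) = cls (k + l) (comm a b) (comm_mem_gam ha hb) := rfl

/-- The biadditive bracket `L^k(G) × L^l(G) → L^{k+l}(G)`, `[ā, b̄] = (a, b)‾`. -/
def br (k l : ℕ+) : Comp G k →+ Comp G l →+ Comp G (k + l) :=
  MonoidHom.toAdditiveLeft <| QuotientGroup.lift ((gam G (k + 1)).subgroupOf (gam G k))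
    (MonoidHom.mk' (fun a : gam G k => Multiplicative.ofAdd (brRight k l a a.2))
      (fun a a' => by
        refine congrArg Multiplicative.ofAdd (AddMonoidHom.ext fun Y => ?_)
        obtain ⟨b, hb, rfl⟩ := cls_surj Y
        exact cls_comm_mul_left a.2 a'.2 hb))
    (fun a ha => by
      refine congrArg Multiplicative.ofAdd (AddMonoidHom.ext fun Y => ?_)
      obtain ⟨b, hb, rfl⟩ := cls_surj Y
      refine (cls_eq_zero_iff _).2 ?_
      have := comm_mem_gam (Subgroup.mem_subgroupOf.1 ha) hb
      rwa [add_right_comm] at this)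

theorem br_cls {k l : ℕ+} {a b : G} (ha : a ∈ gam G k) (hb : b ∈ gam G l) :
    br k l (cls k a ha) (cls l b hb) = cls (k + l) (comm a b) (comm_mem_gam ha hb) := rfl

variable (G) in
/-- The direct sum `L(G) = ⨁_{k ≥ 1} L^k(G)`. -/
abbrev L : Type u := ⨁ k : ℕ+, Comp G k

variable (G) in
/-- The biadditive extension of the brackets `L^k(G) × L^l(G) → L^{k+l}(G)` to `L(G)`. -/
def brHom : L G →+ L G →+ L G :=
  DirectSum.toAddMonoid fun k => AddMonoidHom.flip <| DirectSum.toAddMonoid fun l =>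
    AddMonoidHom.flip <| (DirectSum.of (Comp G) (k + l)).compHom.comp (br k l)

instance : Bracket (L G) (L G) := ⟨fun x y => brHom G x y⟩

theorem lie_def (x y : L G) : ⁅x, y⁆ = brHom G x y := rfl

/-- The bracket in `L(G)` of homogeneous elements. -/
theorem lie_of_of {k l : ℕ+} (X : Comp G k) (Y : Comp G l) :
    ⁅DirectSum.of (Comp G) k X, DirectSum.of (Comp G) l Y⁆ =
      DirectSum.of (Comp G) (k + l) (br k l X Y) := by
  simp [lie_def, brHom]

/-- The class `x̄ ∈ L^k(G) ⊆ L(G)` of `x ∈ γ_k(G)`. -/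
def bar (k : ℕ+) (x : G) (hx : x ∈ gam G k) : L G := DirectSum.of (Comp G) k (cls k x hx)

/-- The defining formula of the bracket: `[ā, b̄] = (a, b)‾`. -/
theorem lie_bar {k l : ℕ+} {a b : G} (ha : a ∈ gam G k) (hb : b ∈ gam G l) :
    ⁅bar k a ha, bar l b hb⁆ = bar (k + l) (comm a b) (comm_mem_gam ha hb) := by
  rw [bar, bar, lie_of_of, br_cls, bar]

theorem bar_inv {k : ℕ+} {x : G} (hx : x ∈ gam G k) :
    bar k x⁻¹ (inv_mem hx) = - bar k x hx := by
  rw [bar, cls_inv, map_neg, bar]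

theorem bar_mul {k : ℕ+} {x y : G} (hx : x ∈ gam G k) (hy : y ∈ gam G k) :
    bar k (x * y) (mul_mem hx hy) = bar k x hx + bar k y hy := by
  rw [bar, cls_mul, map_add, bar, bar]

theorem bar_congr {k l : ℕ+} {x y : G} (hkl : k = l) (h : x = y) (hx : x ∈ gam G k)
    (hy : y ∈ gam G l) : bar k x hx = bar l y hy := by
  subst hkl; subst h; rfl

theorem bar_one {k : ℕ+} (h : (1 : G) ∈ gam G k) : bar k 1 h = 0 := by
  have : cls k (1 : G) h = 0 := (cls_eq_zero_iff h).2 (one_mem _)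
  rw [bar, this, map_zero]

theorem lie_ind {p : L G → Prop} (x : L G) (h0 : p 0) (hadd : ∀ x y, p x → p y → p (x + y))
    (hb : ∀ k a ha, p (bar k a ha)) : p x := by
  induction x using DirectSum.induction_on with
  | zero => exact h0
  | of k X =>
    obtain ⟨a, ha, rfl⟩ := cls_surj X
    exact hb k a ha
  | add x y hx hy => exact hadd x y hx hy

theorem lie_skew_aux (x y : L G) : ⁅x, y⁆ + ⁅y, x⁆ = 0 := by
  simp only [lie_def]
  induction x using lie_ind with
  | h0 => simp
  | hadd x x' hx hx' =>
    simp only [map_add, AddMonoidHom.add_apply]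
    rw [add_add_add_comm, hx, hx', add_zero]
  | hb k a ha =>
    induction y using lie_ind with
    | h0 => simp
    | hadd y y' hy hy' =>
      simp only [map_add, AddMonoidHom.add_apply]
      rw [add_add_add_comm, hy, hy', add_zero]
    | hb l b hb =>
      simp only [← lie_def]
      rw [lie_bar, lie_bar, add_eq_zero_iff_eq_neg, ← bar_inv]
      exact bar_congr (add_comm _ _) (by simp only [comm]; group) _ _

theorem lie_self_aux (x : L G) : ⁅x, x⁆ = 0 := by
  induction x using lie_ind with
  | h0 => simp [lie_def]
  | hadd x y hx hy =>
    have h := lie_skew_aux x y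
    simp only [lie_def, map_add, AddMonoidHom.add_apply] at *
    rw [hx, hy, zero_add, add_zero, add_comm, h]
  | hb k a ha =>
    rw [lie_bar]
    have h : comm a a = 1 := by simp [comm]
    rw [bar_congr rfl h _ (one_mem _), bar_one]

theorem lie_neg_aux (x y : L G) : ⁅x, -y⁆ = -⁅x, y⁆ := by simp [lie_def]

theorem neg_lie_aux (x y : L G) : ⁅-x, y⁆ = -⁅x, y⁆ := by simp [lie_def]

theorem bar_conj {k : ℕ+} {x : G} (hx : x ∈ gam G k) (g : G) :
    bar k (g⁻¹ * x * g) (conj_mem hx g) = bar k x hx := by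
  rw [bar, cls_conj hx, bar]

theorem bar_conj_comm {k l n r : ℕ+} {a b c : G} (ha : a ∈ gam G k) (hb : b ∈ gam G l)
    (hc : c ∈ gam G n) (hr : k + l + n = r)
    (h : b⁻¹ * comm (comm a b⁻¹) c * b ∈ gam G r) :
    bar r (b⁻¹ * comm (comm a b⁻¹) c * b) h = - ⁅⁅bar k a ha, bar l b hb⁆, bar n c hc⁆ := by
  subst hr
  rw [bar_conj (comm_mem_gam (comm_mem_gam ha (inv_mem hb)) hc),
    ← lie_bar (comm_mem_gam ha (inv_mem hb)) hc, ← lie_bar ha (inv_mem hb), bar_inv,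
    lie_neg_aux, neg_lie_aux]

theorem jacobi_bar {k l n : ℕ+} {a b c : G} (ha : a ∈ gam G k) (hb : b ∈ gam G l)
    (hc : c ∈ gam G n) :
    ⁅⁅bar k a ha, bar l b hb⁆, bar n c hc⁆ + ⁅⁅bar l b hb, bar n c hc⁆, bar k a ha⁆ +
      ⁅⁅bar n c hc, bar k a ha⁆, bar l b hb⁆ = 0 := by
  have e2 : l + n + k = k + l + n := by rw [add_comm (l + n), ← add_assoc]
  have e3 : n + k + l = k + l + n := by rw [add_assoc, add_comm n]
  have m1 : b⁻¹ * comm (comm a b⁻¹) c * b ∈ gam G (k + l + n) :=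
    conj_mem (comm_mem_gam (comm_mem_gam ha (inv_mem hb)) hc) b
  have m2 : c⁻¹ * comm (comm b c⁻¹) a * c ∈ gam G (k + l + n) :=
    e2 ▸ conj_mem (comm_mem_gam (comm_mem_gam hb (inv_mem hc)) ha) c
  have m3 : a⁻¹ * comm (comm c a⁻¹) b * a ∈ gam G (k + l + n) :=
    e3 ▸ conj_mem (comm_mem_gam (comm_mem_gam hc (inv_mem ha)) hb) a
  have hw : (b⁻¹ * comm (comm a b⁻¹) c * b) * (c⁻¹ * comm (comm b c⁻¹) a * c) *
      (a⁻¹ * comm (comm c a⁻¹) b * a) = 1 := by simp only [comm]; group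
  have h := bar_congr (k := k + l + n) rfl hw (mul_mem (mul_mem m1 m2) m3) (one_mem _)
  rw [bar_one, bar_mul (mul_mem m1 m2) m3, bar_mul m1 m2, bar_conj_comm ha hb hc rfl,
    bar_conj_comm hb hc ha e2, bar_conj_comm hc ha hb e3, ← neg_add, ← neg_add, neg_eq_zero] at h
  exact h

theorem add_three_aux {A : Type*} [AddCommGroup A] {p p' q q' r r' : A} (h : p + q + r = 0)
    (h' : p' + q' + r' = 0) : p + p' + (q + q') + (r + r') = 0 := by
  have e : p + p' + (q + q') + (r + r') = (p + q + r) + (p' + q' + r') := by abel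
  rw [e, h, h', add_zero]

theorem jacobi_aux (x y z : L G) : ⁅⁅x, y⁆, z⁆ + ⁅⁅y, z⁆, x⁆ + ⁅⁅z, x⁆, y⁆ = 0 := by
  simp only [lie_def]
  induction x using lie_ind with
  | h0 => simp
  | hadd x x' hx hx' =>
    simp only [map_add, AddMonoidHom.add_apply]
    exact add_three_aux hx hx'
  | hb k a ha =>
    induction y using lie_ind with
    | h0 => simp
    | hadd y y' hy hy' =>
      simp only [map_add, AddMonoidHom.add_apply]
      exact add_three_aux hy hy'
    | hb l b hb =>
      induction z using lie_ind with
      | h0 => simp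
      | hadd z z' hz hz' =>
        simp only [map_add, AddMonoidHom.add_apply]
        exact add_three_aux hz hz'
      | hb n c hc => exact jacobi_bar ha hb hc

/-- The Lie algebra (over `ℤ`) associated with the lower central series of `G`. -/
instance : LieRing (L G) where
  add_lie x y z := by simp [lie_def]
  lie_add x y z := by simp [lie_def]
  lie_self := lie_self_aux
  leibniz_lie x y z := by
    have h := jacobi_aux x y z
    have h1 : ⁅⁅y, z⁆, x⁆ = -⁅x, ⁅y, z⁆⁆ := eq_neg_of_add_eq_zero_left (lie_skew_aux _ _)
    have h2 : ⁅⁅z, x⁆, y⁆ = -⁅y, ⁅z, x⁆⁆ := eq_neg_of_add_eq_zero_left (lie_skew_aux _ _)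
    have h3 : ⁅z, x⁆ = -⁅x, z⁆ := eq_neg_of_add_eq_zero_left (lie_skew_aux _ _)
    rw [h1, h2, h3, lie_neg_aux, neg_neg] at h
    rw [← sub_eq_zero, ← neg_eq_zero, ← h]
    abel

/-- If `G` is generated by elements of order dividing `2`, then `2 L^k(G) = 0`. -/
theorem two_nsmul_comp {S : Set G} (hS : Subgroup.closure S = ⊤) (h2 : ∀ s ∈ S, s * s = 1)
    (k : ℕ+) (X : Comp G k) : 2 • X = 0 := by
  induction k using PNat.recOn with
  | one =>
    obtain ⟨x, hx, rfl⟩ := cls_surj X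
    have hx' : x ∈ Subgroup.closure S := hS ▸ Subgroup.mem_top x
    induction hx' using Subgroup.closure_induction with
    | mem s hs =>
      rw [two_nsmul, ← cls_mul, cls_eq_zero_iff, h2 s hs]
      exact one_mem _
    | one => rw [(cls_eq_zero_iff hx).2 (one_mem _), nsmul_zero]
    | mul x y _ _ ihx ihy =>
      have hx1 : x ∈ gam G 1 := Subgroup.mem_top x
      have hy1 : y ∈ gam G 1 := Subgroup.mem_top y
      rw [cls_mul hx1 hy1, nsmul_add, ihx, ihy, add_zero]
    | inv x _ ih =>
      have hx1 : x ∈ gam G 1 := Subgroup.mem_top x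
      rw [cls_inv hx1, nsmul_neg_aux, ih, neg_zero]
  | succ k ih =>
    obtain ⟨x, hx, rfl⟩ := cls_surj X
    have key : ∀ y ∈ ⁅gam G k, (⊤ : Subgroup G)⁆, ∀ hy : y ∈ gam G (k + 1),
        2 • cls (k + 1) y hy = 0 := by
      intro y hy
      rw [Subgroup.commutator_def] at hy
      induction hy using Subgroup.closure_induction with
      | mem s hs =>
        obtain ⟨a, ha, b, hb, rfl⟩ := hs
        intro hy
        have e : a * b * a⁻¹ * b⁻¹ = comm a⁻¹ b⁻¹ := by simp [comm]
        change 2 • cls (k + 1) (a * b * a⁻¹ * b⁻¹) hy = 0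
        rw [cls_congr e, ← br_cls (inv_mem ha) (inv_mem (show b ∈ gam G 1 from hb)),
          ← AddMonoidHom.nsmul_apply, ← map_nsmul, ih, map_zero, AddMonoidHom.zero_apply]
      | one => intro hy; rw [(cls_eq_zero_iff hy).2 (one_mem _), nsmul_zero]
      | mul x y hx hy ihx ihy =>
        intro _
        rw [← Subgroup.commutator_def, ← gam_succ] at hx hy
        rw [cls_mul hx hy, nsmul_add, ihx hx, ihy hy, add_zero]
      | inv x hx ih =>
        intro _
        rw [← Subgroup.commutator_def, ← gam_succ] at hx
        rw [cls_inv hx, nsmul_neg_aux, ih hx, neg_zero]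
    exact key x (gam_succ (G := G) k ▸ hx) hx

end General

section Coxeter

variable {m : ℕ}

/-- The defining relators of the right-angled Coxeter group of a simplicial complex `K` on the
vertex set `[m]`: the squares `g_i²`, and the commutators of `g_i` and `g_j` for `{i, j} ∈ K`.
A Mathlib `AbstractSimplicialComplex` contains all singletons; the empty face, which plays no
role here, is left out by convention. -/
def relators (K : AbstractSimplicialComplex (Fin m)) : Set (FreeGroup (Fin m)) :=
  {r | ∃ i, r = FreeGroup.of i ^ 2} ∪
    {r | ∃ i j, ({i, j} : Finset (Fin m)) ∈ K ∧ r = comm (FreeGroup.of i) (FreeGroup.of j)}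

/-- The right-angled Coxeter group `RC_K`. -/
abbrev RC (K : AbstractSimplicialComplex (Fin m)) : Type := PresentedGroup (relators K)

/-- The generator `g_i` of `RC_K`. -/
def g (K : AbstractSimplicialComplex (Fin m)) (i : Fin m) : RC K := PresentedGroup.of i

theorem g_mul_self (K : AbstractSimplicialComplex (Fin m)) (i : Fin m) : g K i * g K i = 1 := by
  have h : (FreeGroup.of i ^ 2) ∈ relators K := Or.inl ⟨i, rfl⟩
  have := PresentedGroup.one_of_mem h
  rwa [map_pow, pow_two] at this

/-- `L^k(RC_K)` is a vector space over the field of two elements. -/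
instance (K : AbstractSimplicialComplex (Fin m)) (k : ℕ+) : Module (ZMod 2) (Comp (RC K) k) :=
  AddCommGroup.zmodModule <| two_nsmul_comp (PresentedGroup.closure_range_of (relators K))
    (by rintro _ ⟨i, rfl⟩; exact g_mul_self K i) k

/-- `L(RC_K)` is a Lie algebra over the field of two elements. -/
instance (K : AbstractSimplicialComplex (Fin m)) : LieAlgebra (ZMod 2) (L (RC K)) where
  lie_smul t x y := ZMod.map_smul (brHom (RC K) x) t y

/-- The element `ḡ_i` of `L^1(RC_K) ⊆ L(RC_K)`. -/
def gbar (K : AbstractSimplicialComplex (Fin m)) (i : Fin m) : L (RC K) :=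
  bar 1 (g K i) (Subgroup.mem_top _)

/-- The full subcomplex `K_J = {I ∈ K : I ⊆ J}`. -/
def fullSub (K : AbstractSimplicialComplex (Fin m)) (J : Finset (Fin m)) :
    PreAbstractSimplicialComplex (Fin m) where
  faces := {I | I ∈ K ∧ I ⊆ J}
  isRelLowerSet_faces := fun _ hI =>
    ⟨(K.isRelLowerSet_faces hI.1).1, fun _ hle hne =>
      ⟨(K.isRelLowerSet_faces hI.1).2 hle hne, hle.trans hI.2⟩⟩

/-- `C` is the vertex set of a connected component of the simplicial complex `X`: it consists of
all vertices joined by an edge path of `X` to some vertex `v` of `X`. -/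
def IsComponent (X : PreAbstractSimplicialComplex (Fin m)) (C : Set (Fin m)) : Prop :=
  ∃ v, {v} ∈ X ∧
    C = {w | Relation.ReflTransGen (fun a b => ({a, b} : Finset (Fin m)) ∈ X) v w}

/-- The pairs `(i, j)` with `i < j` and `{i, j} ∉ K`. -/
def Pairs (K : AbstractSimplicialComplex (Fin m)) : Type :=
  {p : Fin m × Fin m // p.1 < p.2 ∧ ({p.1, p.2} : Finset (Fin m)) ∉ K}

/-- The triples `(i, j, k)` with `i < j > k`, `i ≠ k`, such that `i` is the smallest vertex in a
connected component of `K_{i,j,k}` not containing `j`. -/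
def Triples (K : AbstractSimplicialComplex (Fin m)) : Type :=
  {t : Fin m × Fin m × Fin m // t.1 < t.2.1 ∧ t.2.2 < t.2.1 ∧ t.1 ≠ t.2.2 ∧
    ∃ C, IsComponent (fullSub K {t.1, t.2.1, t.2.2}) C ∧ t.2.1 ∉ C ∧ IsLeast C t.1}

end Coxeter

end AssocLie

/-!
The listed elements span because `L^{k+1}(G)` is generated by brackets of generators of `L^k(G)`
with generators of `L^1(G)` (`addSubgroup_comp_succ_eq_top`), so that only brackets of the `ḡ_i`
have to be considered. These are reduced to the listed ones by antisymmetry (which is symmetry in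
characteristic two), the vanishing of `[ḡ_i, ḡ_j]` on edges, the identity
`[ḡ_i, ḡ_j, ḡ_i] = [ḡ_i, ḡ_j, ḡ_j]`, which holds since both commutators equal `(g_j g_i)⁴`, and
the Jacobi identity for three distinct generators (`gcls₃_mem_span`). The condition on connected
components is first translated into a condition on edges (`exists_component_iff`).

For linear independence, each listed element is given a functional to the field of two elements
which is `1` on it and `0` on the other ones (`linearIndependent_of_functionals`). The functionals
come from homomorphisms of `RC_K` to small nilpotent groups. In degree one the target is cyclic of
order two. In degree two it is the group of unitriangular `4 × 4` matrices over the field of two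
elements, which also detects the triples in degree three: a path `p - q - r` in the complement
graph lets `g_p`, `g_q`, `g_r` act as the elementary matrices on the first superdiagonal
(`exists_uniTri_functional`), and a suitable choice of the middle vertex `q` separates the at most
two listed triples with the same entries. That group has exponent four, and so misses
`[ḡ_i, ḡ_j, ḡ_j]`; these elements are detected by the dihedral group of order sixteen, with all
generators other than `g_i`, `g_j` sent to `1` (`exists_dihedral_functional`).
-/

namespace AssocLie

/-! ### Maps out of the graded components, and generators of them -/

section Functionals

universe u

variable {G : Type u} [Group G]

theorem map_mem_gam {H : Type*} [Group H] (φ : G →* H) {k : ℕ+} {x : G} (hx : x ∈ gam G k) :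
    φ x ∈ gam H k := by
  suffices h : (gam G k).map φ ≤ gam H k from h (Subgroup.mem_map_of_mem φ hx)
  induction k using PNat.recOn generalizing x with
  | one => exact fun _ _ => Subgroup.mem_top _
  | succ k ih =>
    rw [gam_succ, gam_succ, Subgroup.map_commutator]
    refine Subgroup.commutator_mono ?_ le_top
    rintro _ ⟨y, hy, rfl⟩
    exact ih hy (Subgroup.mem_map_of_mem φ hy)

/-- The additive map on `L^k(G)` induced by a function on `G` which is additive on `γ_k(G)` and
vanishes on `γ_{k+1}(G)`. -/
def compLift {A : Type*} [AddGroup A] (k : ℕ+) (f : G → A)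
    (hmul : ∀ x ∈ gam G k, ∀ y ∈ gam G k, f (x * y) = f x + f y)
    (hzero : ∀ x ∈ gam G (k + 1), f x = 0) : Comp G k →+ A :=
  MonoidHom.toAdditiveLeft <| QuotientGroup.lift ((gam G (k + 1)).subgroupOf (gam G k))
    (MonoidHom.mk' (fun x : gam G k => Multiplicative.ofAdd (f x))
      (fun x y => congrArg Multiplicative.ofAdd (hmul x x.2 y y.2)))
    (fun x hx => congrArg Multiplicative.ofAdd (hzero x (Subgroup.mem_subgroupOf.1 hx)))

theorem compLift_cls {A : Type*} [AddGroup A] {k : ℕ+} {f : G → A}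
    (hmul : ∀ x ∈ gam G k, ∀ y ∈ gam G k, f (x * y) = f x + f y)
    (hzero : ∀ x ∈ gam G (k + 1), f x = 0) {x : G} (hx : x ∈ gam G k) :
    compLift k f hmul hzero (cls k x hx) = f x := rfl

theorem comm_one_left (b : G) : comm 1 b = 1 := by simp [comm]

theorem comm_one_right (a : G) : comm a 1 = 1 := by simp [comm]

theorem map_comm {H : Type*} [Group H] (φ : G →* H) (a b : G) :
    φ (comm a b) = comm (φ a) (φ b) := by simp [comm]

theorem addSubgroup_comp_one_eq_top {S : Set G} (hS : Subgroup.closure S = ⊤)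
    (M : AddSubgroup (Comp G 1)) (h : ∀ s ∈ S, cls 1 s (Subgroup.mem_top s) ∈ M) : M = ⊤ := by
  refine (AddSubgroup.eq_top_iff' M).2 fun X => ?_
  obtain ⟨x, hx, rfl⟩ := cls_surj X
  have hx' : x ∈ Subgroup.closure S := hS ▸ Subgroup.mem_top x
  induction hx' using Subgroup.closure_induction with
  | mem s hs => exact h s hs
  | one => rw [(cls_eq_zero_iff hx).2 (one_mem _)]; exact zero_mem _
  | mul x y _ _ ihx ihy =>
    have hx1 : x ∈ gam G 1 := Subgroup.mem_top x
    have hy1 : y ∈ gam G 1 := Subgroup.mem_top y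
    rw [cls_mul hx1 hy1]
    exact add_mem (ihx hx1) (ihy hy1)
  | inv x _ ih =>
    have hx1 : x ∈ gam G 1 := Subgroup.mem_top x
    rw [cls_inv hx1]
    exact neg_mem (ih hx1)

/-- `L^{k+1}(G)` is generated by the brackets of generators of `L^k(G)` with generators
of `L^1(G)`. -/
theorem addSubgroup_comp_succ_eq_top {k : ℕ+} {S : Set (Comp G k)} {T : Set (Comp G 1)}
    (hS : AddSubgroup.closure S = ⊤) (hT : AddSubgroup.closure T = ⊤)
    (M : AddSubgroup (Comp G (k + 1))) (h : ∀ s ∈ S, ∀ t ∈ T, br k 1 s t ∈ M) : M = ⊤ := by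
  have hbr : ∀ X Y, br k 1 X Y ∈ M := by
    intro X Y
    have hX : X ∈ AddSubgroup.closure S := hS ▸ AddSubgroup.mem_top X
    have hY : Y ∈ AddSubgroup.closure T := hT ▸ AddSubgroup.mem_top Y
    induction hX using AddSubgroup.closure_induction with
    | mem s hs =>
      induction hY using AddSubgroup.closure_induction with
      | mem t ht => exact h s hs t ht
      | zero => rw [map_zero]; exact zero_mem _
      | add y y' _ _ ih ih' => rw [map_add]; exact add_mem ih ih'
      | neg y _ ih => rw [map_neg]; exact neg_mem ih
    | zero => rw [map_zero]; exact zero_mem _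
    | add x x' _ _ ih ih' => rw [map_add]; exact add_mem ih ih'
    | neg x _ ih => rw [map_neg]; exact neg_mem ih
  refine (AddSubgroup.eq_top_iff' M).2 fun X => ?_
  obtain ⟨x, hx, rfl⟩ := cls_surj X
  have key : ∀ y ∈ ⁅gam G k, (⊤ : Subgroup G)⁆, ∀ hy : y ∈ gam G (k + 1),
      cls (k + 1) y hy ∈ M := by
    intro y hy
    rw [Subgroup.commutator_def] at hy
    induction hy using Subgroup.closure_induction with
    | mem s hs =>
      obtain ⟨a, ha, b, hb, rfl⟩ := hs
      intro hy
      have e : a * b * a⁻¹ * b⁻¹ = comm a⁻¹ b⁻¹ := by simp [comm]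
      change cls (k + 1) (a * b * a⁻¹ * b⁻¹) hy ∈ M
      rw [cls_congr e, ← br_cls (inv_mem ha) (inv_mem (show b ∈ gam G 1 from hb))]
      exact hbr _ _
    | one => intro hy; rw [(cls_eq_zero_iff hy).2 (one_mem _)]; exact zero_mem _
    | mul x y hx hy ihx ihy =>
      intro _
      rw [← Subgroup.commutator_def, ← gam_succ] at hx hy
      rw [cls_mul hx hy]
      exact add_mem (ihx hx) (ihy hy)
    | inv x hx ih =>
      intro _
      rw [← Subgroup.commutator_def, ← gam_succ] at hx
      rw [cls_inv hx]
      exact neg_mem (ih hx)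
  exact key x (gam_succ (G := G) k ▸ hx) hx

end Functionals

/-! ### Unitriangular matrices of size four -/

section Unitriangular

/-- The upper unitriangular `4 × 4` matrices over `R`, by their entries above the diagonal. -/
@[ext]
structure UniTri (R : Type*) where
  /-- the `(1, 2)` entry -/
  x₁₂ : R
  /-- the `(2, 3)` entry -/
  x₂₃ : R
  /-- the `(3, 4)` entry -/
  x₃₄ : R
  /-- the `(1, 3)` entry -/
  x₁₃ : R
  /-- the `(2, 4)` entry -/
  x₂₄ : R
  /-- the `(1, 4)` entry -/
  x₁₄ : R

namespace UniTri

variable {R : Type*} [CommRing R]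

instance : Mul (UniTri R) where
  mul x y :=
    { x₁₂ := x.x₁₂ + y.x₁₂
      x₂₃ := x.x₂₃ + y.x₂₃
      x₃₄ := x.x₃₄ + y.x₃₄
      x₁₃ := x.x₁₃ + y.x₁₃ + x.x₁₂ * y.x₂₃
      x₂₄ := x.x₂₄ + y.x₂₄ + x.x₂₃ * y.x₃₄
      x₁₄ := x.x₁₄ + y.x₁₄ + x.x₁₂ * y.x₂₄ + x.x₁₃ * y.x₃₄ }

instance : One (UniTri R) := ⟨⟨0, 0, 0, 0, 0, 0⟩⟩

instance : Inv (UniTri R) where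
  inv x :=
    { x₁₂ := -x.x₁₂
      x₂₃ := -x.x₂₃
      x₃₄ := -x.x₃₄
      x₁₃ := x.x₁₂ * x.x₂₃ - x.x₁₃
      x₂₄ := x.x₂₃ * x.x₃₄ - x.x₂₄
      x₁₄ := x.x₁₂ * x.x₂₄ + x.x₁₃ * x.x₃₄ - x.x₁₂ * x.x₂₃ * x.x₃₄ - x.x₁₄ }

section

variable (x y : UniTri R)

@[simp] theorem mul_x₁₂ : (x * y).x₁₂ = x.x₁₂ + y.x₁₂ := rfl
@[simp] theorem mul_x₂₃ : (x * y).x₂₃ = x.x₂₃ + y.x₂₃ := rfl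
@[simp] theorem mul_x₃₄ : (x * y).x₃₄ = x.x₃₄ + y.x₃₄ := rfl
@[simp] theorem mul_x₁₃ : (x * y).x₁₃ = x.x₁₃ + y.x₁₃ + x.x₁₂ * y.x₂₃ := rfl
@[simp] theorem mul_x₂₄ : (x * y).x₂₄ = x.x₂₄ + y.x₂₄ + x.x₂₃ * y.x₃₄ := rfl
@[simp] theorem mul_x₁₄ :
    (x * y).x₁₄ = x.x₁₄ + y.x₁₄ + x.x₁₂ * y.x₂₄ + x.x₁₃ * y.x₃₄ := rfl
@[simp] theorem one_x₁₂ : (1 : UniTri R).x₁₂ = 0 := rfl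
@[simp] theorem one_x₂₃ : (1 : UniTri R).x₂₃ = 0 := rfl
@[simp] theorem one_x₃₄ : (1 : UniTri R).x₃₄ = 0 := rfl
@[simp] theorem one_x₁₃ : (1 : UniTri R).x₁₃ = 0 := rfl
@[simp] theorem one_x₂₄ : (1 : UniTri R).x₂₄ = 0 := rfl
@[simp] theorem one_x₁₄ : (1 : UniTri R).x₁₄ = 0 := rfl
@[simp] theorem inv_x₁₂ : x⁻¹.x₁₂ = -x.x₁₂ := rfl
@[simp] theorem inv_x₂₃ : x⁻¹.x₂₃ = -x.x₂₃ := rfl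
@[simp] theorem inv_x₃₄ : x⁻¹.x₃₄ = -x.x₃₄ := rfl
@[simp] theorem inv_x₁₃ : x⁻¹.x₁₃ = x.x₁₂ * x.x₂₃ - x.x₁₃ := rfl
@[simp] theorem inv_x₂₄ : x⁻¹.x₂₄ = x.x₂₃ * x.x₃₄ - x.x₂₄ := rfl
@[simp] theorem inv_x₁₄ :
    x⁻¹.x₁₄ = x.x₁₂ * x.x₂₄ + x.x₁₃ * x.x₃₄ - x.x₁₂ * x.x₂₃ * x.x₃₄ - x.x₁₄ := rfl

end

instance : Group (UniTri R) :=
  Group.ofLeftAxioms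
    (fun x y z => by
      ext <;> simp only [mul_x₁₂, mul_x₂₃, mul_x₃₄, mul_x₁₃, mul_x₂₄, mul_x₁₄] <;> ring)
    (fun x => by ext <;> simp)
    (fun x => by ext <;> simp; ring)

variable (R) in
/-- The matrices which vanish on the first superdiagonal. -/
def superTwo : Subgroup (UniTri R) where
  carrier := {x | x.x₁₂ = 0 ∧ x.x₂₃ = 0 ∧ x.x₃₄ = 0}
  one_mem' := ⟨rfl, rfl, rfl⟩
  mul_mem' := by rintro x y ⟨h₁, h₂, h₃⟩ ⟨h₁', h₂', h₃'⟩; simp [*]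
  inv_mem' := by rintro x ⟨h₁, h₂, h₃⟩; simp [*]

variable (R) in
/-- The matrices which vanish on the first two superdiagonals. -/
def superThree : Subgroup (UniTri R) where
  carrier := {x | x.x₁₂ = 0 ∧ x.x₂₃ = 0 ∧ x.x₃₄ = 0 ∧ x.x₁₃ = 0 ∧ x.x₂₄ = 0}
  one_mem' := ⟨rfl, rfl, rfl, rfl, rfl⟩
  mul_mem' := by rintro x y ⟨h₁, h₂, h₃, h₄, h₅⟩ ⟨h₁', h₂', h₃', h₄', h₅'⟩; simp [*]
  inv_mem' := by rintro x ⟨h₁, h₂, h₃, h₄, h₅⟩; simp [*]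

theorem gam_two_le : gam (UniTri R) 2 ≤ superTwo R := by
  change gam (UniTri R) (1 + 1) ≤ _
  rw [gam_succ, Subgroup.commutator_le]
  intro x _ y _
  simp [superTwo, commutatorElement_def]

theorem gam_three_le : gam (UniTri R) 3 ≤ superThree R := by
  change gam (UniTri R) (2 + 1) ≤ _
  rw [gam_succ, Subgroup.commutator_le]
  intro x hx y _
  obtain ⟨h₁, h₂, h₃⟩ := gam_two_le hx
  simp [superThree, commutatorElement_def, h₁, h₂, h₃]

theorem gam_four_le : gam (UniTri R) 4 ≤ ⊥ := by
  change gam (UniTri R) (3 + 1) ≤ _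
  rw [gam_succ, Subgroup.commutator_le]
  intro x hx y _
  obtain ⟨h₁, h₂, h₃, h₄, h₅⟩ := gam_three_le hx
  rw [Subgroup.mem_bot]
  ext <;> simp [commutatorElement_def, h₁, h₂, h₃, h₄, h₅]
  ring

theorem comm_x₁₃ (x y : UniTri R) : (comm x y).x₁₃ = x.x₁₂ * y.x₂₃ - y.x₁₂ * x.x₂₃ := by
  simp only [comm, mul_x₁₃, mul_x₁₂, inv_x₁₃, inv_x₁₂, inv_x₂₃]
  ring

theorem comm_comm_x₁₄ (x y z : UniTri R) :
    (comm (comm x y) z).x₁₄ = (x.x₁₂ * y.x₂₃ - y.x₁₂ * x.x₂₃) * z.x₃₄ -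
      (x.x₂₃ * y.x₃₄ - y.x₂₃ * x.x₃₄) * z.x₁₂ := by
  simp only [comm, mul_x₁₂, mul_x₂₃, mul_x₃₄, mul_x₁₃, mul_x₂₄, mul_x₁₄, inv_x₁₂, inv_x₂₃,
    inv_x₃₄, inv_x₁₃, inv_x₂₄, inv_x₁₄]
  ring

end UniTri

end Unitriangular

/-! ### The dihedral group of order sixteen -/

section Dihedral

open DihedralGroup

/-- The subgroup of rotations `r (d * c)` in the dihedral group. -/
def rotations {n : ℕ} (d : ZMod n) : Subgroup (DihedralGroup n) where
  carrier := {x | ∃ c, x = r (d * c)}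
  one_mem' := ⟨0, by simp⟩
  mul_mem' := by
    rintro _ _ ⟨a, rfl⟩ ⟨b, rfl⟩
    exact ⟨a + b, by rw [r_mul_r, mul_add]⟩
  inv_mem' := by
    rintro _ ⟨a, rfl⟩
    exact ⟨-a, by rw [inv_r, mul_neg]⟩

theorem gam_dihedral_le {n : ℕ} (k : ℕ+) :
    gam (DihedralGroup n) (k + 1) ≤ rotations (2 ^ (k : ℕ)) := by
  induction k using PNat.recOn with
  | one =>
    rw [gam_succ, Subgroup.commutator_le]
    rintro (i | i) _ (j | j) _
    · exact ⟨0, by simp [commutatorElement_def]⟩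
    · exact ⟨i, by simp [commutatorElement_def]; ring⟩
    · exact ⟨-j, by simp [commutatorElement_def]; ring⟩
    · exact ⟨j - i, by simp [commutatorElement_def]; ring⟩
  | succ k ih =>
    rw [gam_succ, Subgroup.commutator_le]
    intro x hx y _
    obtain ⟨c, rfl⟩ := ih hx
    rcases y with j | j
    · exact ⟨0, by simp [commutatorElement_def]⟩
    · exact ⟨c, by simp [commutatorElement_def, pow_succ]; ring⟩

/-- The additive functional on `⟨r 4⟩ ≤ DihedralGroup 8` which does not vanish at `r 4`. -/
def rotFun (x : DihedralGroup 8) : ZMod 2 := if x = 1 then 0 else 1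

theorem rotFun_mul {x y : DihedralGroup 8} (hx : x ∈ gam (DihedralGroup 8) 3)
    (hy : y ∈ gam (DihedralGroup 8) 3) : rotFun (x * y) = rotFun x + rotFun y := by
  obtain ⟨a, rfl⟩ := gam_dihedral_le 2 hx
  obtain ⟨b, rfl⟩ := gam_dihedral_le 2 hy
  clear hx hy
  revert a b
  decide

theorem rotFun_eq_zero {x : DihedralGroup 8} (hx : x ∈ gam (DihedralGroup 8) 4) :
    rotFun x = 0 := by
  obtain ⟨a, rfl⟩ := gam_dihedral_le 3 hx
  clear hx
  revert a
  decide

end Dihedral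

/-! ### Brackets of generators of a right-angled Coxeter group -/

section Presentation

variable {m : ℕ} (K : AbstractSimplicialComplex (Fin m))

theorem g_inv (i : Fin m) : (g K i)⁻¹ = g K i := inv_eq_of_mul_eq_one_left (g_mul_self K i)

theorem comm_g_eq_one {i j : Fin m} (h : ({i, j} : Finset (Fin m)) ∈ K) :
    comm (g K i) (g K j) = 1 := by
  have := PresentedGroup.one_of_mem (rels := relators K) (Or.inr ⟨i, j, h, rfl⟩)
  rwa [map_comm] at this

variable {K}

/-- The homomorphism from `RC_K` given by the images of the generators. -/
def rcLift {H : Type*} [Group H] (f : Fin m → H) (hsq : ∀ i, f i * f i = 1)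
    (hcomm : ∀ i j, ({i, j} : Finset (Fin m)) ∈ K → comm (f i) (f j) = 1) : RC K →* H :=
  PresentedGroup.toGroup (f := f) (by
    rintro _ (⟨i, rfl⟩ | ⟨i, j, h, rfl⟩)
    · rw [map_pow, FreeGroup.lift_apply_of, pow_two, hsq]
    · rw [map_comm, FreeGroup.lift_apply_of, FreeGroup.lift_apply_of, hcomm i j h])

theorem rcLift_g {H : Type*} [Group H] (f : Fin m → H) (hsq : ∀ i, f i * f i = 1)
    (hcomm : ∀ i j, ({i, j} : Finset (Fin m)) ∈ K → comm (f i) (f j) = 1) (i : Fin m) :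
    rcLift (K := K) f hsq hcomm (g K i) = f i := PresentedGroup.toGroup.of _

variable (K)

/-- The class of `g_i` in `L^1(RC_K)`. -/
def gcls (i : Fin m) : Comp (RC K) 1 := cls 1 (g K i) (Subgroup.mem_top _)

theorem comm_g_mem (i j : Fin m) : comm (g K i) (g K j) ∈ gam (RC K) 2 :=
  comm_mem_gam (k := 1) (l := 1) (Subgroup.mem_top _) (Subgroup.mem_top _)

/-- The element `[ḡ_i, ḡ_j]` of `L^2(RC_K)`. -/
def gcls₂ (i j : Fin m) : Comp (RC K) 2 := cls 2 (comm (g K i) (g K j)) (comm_g_mem K i j)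

theorem comm_comm_g_mem (i j k : Fin m) :
    comm (comm (g K i) (g K j)) (g K k) ∈ gam (RC K) 3 :=
  comm_mem_gam (k := 2) (l := 1) (comm_g_mem K i j) (Subgroup.mem_top _)

/-- The element `[ḡ_i, ḡ_j, ḡ_k]` of `L^3(RC_K)`. -/
def gcls₃ (i j k : Fin m) : Comp (RC K) 3 :=
  cls 3 (comm (comm (g K i) (g K j)) (g K k)) (comm_comm_g_mem K i j k)

theorem of_gcls (i : Fin m) : DirectSum.of (Comp (RC K)) 1 (gcls K i) = gbar K i := rfl

theorem of_gcls₂ (i j : Fin m) :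
    DirectSum.of (Comp (RC K)) 2 (gcls₂ K i j) = ⁅gbar K i, gbar K j⁆ := by
  have h (v : Fin m) : g K v ∈ gam (RC K) 1 := Subgroup.mem_top _
  exact ((lie_bar (h i) (h j)).trans (bar_congr rfl rfl _ _)).symm

theorem of_gcls₃ (i j k : Fin m) :
    DirectSum.of (Comp (RC K)) 3 (gcls₃ K i j k) = ⁅⁅gbar K i, gbar K j⁆, gbar K k⁆ := by
  have h (v : Fin m) : g K v ∈ gam (RC K) 1 := Subgroup.mem_top _
  rw [← of_gcls₂]
  exact ((lie_bar (comm_g_mem K i j) (h k)).trans (bar_congr rfl rfl _ _)).symm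

theorem gcls₂_comm (i j : Fin m) : gcls₂ K i j = gcls₂ K j i := by
  refine DirectSum.of_injective (β := Comp (RC K)) 2 ?_
  rw [of_gcls₂, of_gcls₂, ← lie_skew, ZModModule.neg_eq_self]

theorem gcls₂_eq_zero {i j : Fin m} (h : ({i, j} : Finset (Fin m)) ∈ K) : gcls₂ K i j = 0 := by
  rw [gcls₂, cls_eq_zero_iff, comm_g_eq_one K h]
  exact one_mem _

theorem gcls₃_comm (i j k : Fin m) : gcls₃ K i j k = gcls₃ K j i k := by
  refine DirectSum.of_injective (β := Comp (RC K)) 3 ?_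
  rw [of_gcls₃, of_gcls₃, ← lie_skew (gbar K i), neg_lie, ZModModule.neg_eq_self]

theorem gcls₃_eq_zero {i j : Fin m} (h : ({i, j} : Finset (Fin m)) ∈ K) (k : Fin m) :
    gcls₃ K i j k = 0 := by
  rw [gcls₃, cls_eq_zero_iff, comm_g_eq_one K h, comm_one_left]
  exact one_mem _

theorem gcls₃_jacobi (i j k : Fin m) :
    gcls₃ K i j k + gcls₃ K j k i + gcls₃ K k i j = 0 := by
  refine DirectSum.of_injective (β := Comp (RC K)) 3 ?_
  rw [map_add, map_add, map_zero, of_gcls₃, of_gcls₃, of_gcls₃]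
  exact jacobi_aux _ _ _

/-- In a dihedral group generated by involutions `a` and `b`, both `((a, b), a)` and `((a, b), b)`
are equal to `(b a)⁴`. -/
theorem gcls₃_left_eq_right (i j : Fin m) : gcls₃ K i j i = gcls₃ K i j j := by
  refine cls_congr (y := comm (comm (g K i) (g K j)) (g K j)) ?_ (comm_comm_g_mem K i j i)
  simp only [comm, mul_inv_rev, g_inv, mul_assoc, g_mul_self, mul_one]

end Presentation

/-! ### The condition on connected components in terms of edges -/

section Triples

variable {m : ℕ} {K : AbstractSimplicialComplex (Fin m)}

theorem mem_fullSub {J I : Finset (Fin m)} : I ∈ fullSub K J ↔ I ∈ K ∧ I ⊆ J := Iff.rfl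

theorem pair_self_mem (v : Fin m) : ({v, v} : Finset (Fin m)) ∈ K := by
  rw [Finset.pair_eq_singleton]
  exact K.singleton_mem v

/-- The condition on components which defines `Triples K`, in terms of edges: an edge from the
first vertex to the second one is excluded, and an edge from the first vertex to the third one
forces the component of the first vertex to be the set of these two, with the first one smaller. -/
theorem exists_component_iff {i j k : Fin m} (hij : i < j) (hkj : k < j) :
    (∃ C, IsComponent (fullSub K {i, j, k}) C ∧ j ∉ C ∧ IsLeast C i) ↔
      ({i, j} : Finset (Fin m)) ∉ K ∧
        (({i, k} : Finset (Fin m)) ∈ K → i ≤ k ∧ ({j, k} : Finset (Fin m)) ∉ K) := by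
  constructor
  · rintro ⟨_, ⟨v, hv, rfl⟩, hj, hi, hmin⟩
    have step {a b : Fin m} (ha : a ∈ {w | Relation.ReflTransGen
        (fun a b => ({a, b} : Finset (Fin m)) ∈ fullSub K {i, j, k}) v w})
        (hab : {a, b} ∈ fullSub K {i, j, k}) : b ∈ {w | Relation.ReflTransGen
        (fun a b => ({a, b} : Finset (Fin m)) ∈ fullSub K {i, j, k}) v w} :=
      Relation.ReflTransGen.tail ha hab
    refine ⟨fun h => hj (step hi ⟨h, by grind⟩), fun h => ?_⟩
    have hk := step hi (b := k) ⟨h, by grind⟩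
    exact ⟨hmin hk, fun h' => hj (step hk ⟨by rwa [Finset.pair_comm], by grind⟩)⟩
  · rintro ⟨h₁, h₂⟩
    refine ⟨_, ⟨i, ⟨K.singleton_mem i, by grind⟩, rfl⟩, ?_⟩
    have key : ∀ w, Relation.ReflTransGen
        (fun a b => ({a, b} : Finset (Fin m)) ∈ fullSub K {i, j, k}) i w →
        w = i ∨ (w = k ∧ ({i, k} : Finset (Fin m)) ∈ K) := by
      intro w hw
      induction hw with
      | refl => exact Or.inl rfl
      | @tail b c _ hbc ih =>
        obtain ⟨hK, hsub⟩ := mem_fullSub.1 hbc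
        have hc : c = i ∨ c = j ∨ c = k := by
          simpa using hsub (Finset.mem_insert_of_mem (Finset.mem_singleton_self c))
        rcases ih with rfl | ⟨rfl, hik⟩
        · rcases hc with rfl | rfl | rfl
          · exact Or.inl rfl
          · exact absurd hK h₁
          · exact Or.inr ⟨rfl, hK⟩
        · rcases hc with rfl | rfl | rfl
          · exact Or.inl rfl
          · exact absurd (Finset.pair_comm b c ▸ hK) (h₂ hik).2
          · exact Or.inr ⟨rfl, hik⟩
    refine ⟨fun hj => ?_, Relation.ReflTransGen.refl, fun w hw => ?_⟩
    · rcases key j hj with h | ⟨h, -⟩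
      · exact hij.ne' h
      · exact hkj.ne' h
    · rcases key w hw with rfl | ⟨rfl, h⟩
      · exact le_rfl
      · exact (h₂ h).1

end Triples

/-! ### Spanning sets -/

section Spanning

variable {m : ℕ} (K : AbstractSimplicialComplex (Fin m))

theorem addSubgroup_eq_top_of_gcls (M : AddSubgroup (Comp (RC K) 1)) (h : ∀ i, gcls K i ∈ M) :
    M = ⊤ :=
  addSubgroup_comp_one_eq_top (PresentedGroup.closure_range_of (relators K)) M
    (by rintro _ ⟨i, rfl⟩; exact h i)

theorem addSubgroup_eq_top_of_gcls₂ (M : AddSubgroup (Comp (RC K) 2))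
    (h : ∀ i j, gcls₂ K i j ∈ M) : M = ⊤ := by
  have h₁ : AddSubgroup.closure (Set.range (gcls K)) = ⊤ :=
    addSubgroup_eq_top_of_gcls K _ fun i => AddSubgroup.subset_closure ⟨i, rfl⟩
  refine addSubgroup_comp_succ_eq_top (k := 1) h₁ h₁ M ?_
  rintro _ ⟨i, rfl⟩ _ ⟨j, rfl⟩
  exact h i j

theorem addSubgroup_eq_top_of_gcls₃ (M : AddSubgroup (Comp (RC K) 3))
    (h : ∀ i j k, gcls₃ K i j k ∈ M) : M = ⊤ := by
  have h₁ : AddSubgroup.closure (Set.range (gcls K)) = ⊤ :=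
    addSubgroup_eq_top_of_gcls K _ fun i => AddSubgroup.subset_closure ⟨i, rfl⟩
  have h₂ : AddSubgroup.closure (Set.range fun p : Fin m × Fin m => gcls₂ K p.1 p.2) = ⊤ :=
    addSubgroup_eq_top_of_gcls₂ K _ fun i j => AddSubgroup.subset_closure ⟨(i, j), rfl⟩
  refine addSubgroup_comp_succ_eq_top (k := 2) h₂ h₁ M ?_
  rintro _ ⟨⟨i, j⟩, rfl⟩ _ ⟨k, rfl⟩
  exact h i j k

/-- The listed elements of `L^2(RC_K)`. -/
def pairVec (p : Pairs K) : Comp (RC K) 2 := gcls₂ K p.1.1 p.1.2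

/-- The listed elements of `L^3(RC_K)`. -/
def tripleVec : Pairs K ⊕ Triples K → Comp (RC K) 3
  | Sum.inl p => gcls₃ K p.1.1 p.1.2 p.1.2
  | Sum.inr t => gcls₃ K t.1.1 t.1.2.1 t.1.2.2

theorem span_gcls : ⊤ ≤ Submodule.span (ZMod 2) (Set.range (gcls K)) := by
  have := addSubgroup_eq_top_of_gcls K
    (Submodule.span (ZMod 2) (Set.range (gcls K))).toAddSubgroup
    fun i => Submodule.subset_span ⟨i, rfl⟩
  exact fun x _ => (AddSubgroup.eq_top_iff' _).1 this x

theorem span_pairVec : ⊤ ≤ Submodule.span (ZMod 2) (Set.range (pairVec K)) := by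
  have mem {i j : Fin m} (hij : i < j) :
      gcls₂ K i j ∈ Submodule.span (ZMod 2) (Set.range (pairVec K)) := by
    by_cases h : ({i, j} : Finset (Fin m)) ∈ K
    · rw [gcls₂_eq_zero K h]; exact zero_mem _
    · exact Submodule.subset_span ⟨⟨(i, j), hij, h⟩, rfl⟩
  have := addSubgroup_eq_top_of_gcls₂ K
    (Submodule.span (ZMod 2) (Set.range (pairVec K))).toAddSubgroup fun i j => by
      rcases lt_trichotomy i j with h | rfl | h
      · exact mem h
      · rw [gcls₂_eq_zero K (pair_self_mem i)]; exact zero_mem _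
      · rw [gcls₂_comm]; exact mem h
  exact fun x _ => (AddSubgroup.eq_top_iff' _).1 this x

/-- The three brackets of distinct generators `x < y < z`. Each of the two with `z` in the middle
is listed, or vanishes, or is reduced to the other one by the Jacobi identity because the third
bracket vanishes; together the two yield the third one. -/
theorem gcls₃_mem_span_of_lt {x y z : Fin m} (hxy : x < y) (hyz : y < z) :
    gcls₃ K x z y ∈ Submodule.span (ZMod 2) (Set.range (tripleVec K)) ∧
    gcls₃ K y z x ∈ Submodule.span (ZMod 2) (Set.range (tripleVec K)) ∧
    gcls₃ K x y z ∈ Submodule.span (ZMod 2) (Set.range (tripleVec K)) := by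
  set M := Submodule.span (ZMod 2) (Set.range (tripleVec K))
  have hxz := hxy.trans hyz
  have listed {i j k : Fin m} (hij : i < j) (hkj : k < j) (hik : i ≠ k)
      (h₁ : ({i, j} : Finset (Fin m)) ∉ K)
      (h₂ : ({i, k} : Finset (Fin m)) ∈ K → i ≤ k ∧ ({j, k} : Finset (Fin m)) ∉ K) :
      gcls₃ K i j k ∈ M :=
    Submodule.subset_span
      ⟨Sum.inr ⟨(i, j, k), hij, hkj, hik, (exists_component_iff hij hkj).2 ⟨h₁, h₂⟩⟩, rfl⟩
  have jac : gcls₃ K x y z + gcls₃ K y z x + gcls₃ K x z y = 0 := by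
    rw [gcls₃_comm K x z]; exact gcls₃_jacobi K x y z
  have vanish {i j k : Fin m} (h : ({i, j} : Finset (Fin m)) ∈ K) : gcls₃ K i j k = 0 :=
    gcls₃_eq_zero K h k
  have hA : gcls₃ K x z y ∈ M := by
    by_cases hE : ({x, z} : Finset (Fin m)) ∈ K
    · rw [vanish hE]; exact zero_mem _
    · by_cases h : ({x, y} : Finset (Fin m)) ∈ K ∧ ({y, z} : Finset (Fin m)) ∈ K
      · rw [vanish h.1, vanish h.2, zero_add, zero_add] at jac
        rw [jac]; exact zero_mem _
      · exact listed hxz hyz hxy.ne hE fun h' =>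
          ⟨hxy.le, fun h'' => h ⟨h', by rwa [Finset.pair_comm]⟩⟩
  have hB : gcls₃ K y z x ∈ M := by
    by_cases hE : ({y, z} : Finset (Fin m)) ∈ K
    · rw [vanish hE]; exact zero_mem _
    · by_cases h : ({x, y} : Finset (Fin m)) ∈ K
      · rw [vanish h, zero_add] at jac
        rw [eq_neg_of_add_eq_zero_left jac]; exact neg_mem hA
      · exact listed hyz hxz hxy.ne' hE fun h' => absurd (Finset.pair_comm y x ▸ h') h
  refine ⟨hA, hB, ?_⟩
  rw [add_assoc] at jac
  rw [eq_neg_of_add_eq_zero_left jac]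
  exact neg_mem (add_mem hB hA)

theorem gcls₃_mem_span (i j k : Fin m) :
    gcls₃ K i j k ∈ Submodule.span (ZMod 2) (Set.range (tripleVec K)) := by
  wlog hij : i < j generalizing i j with H
  · rcases (not_lt.1 hij).lt_or_eq with h | rfl
    · rw [gcls₃_comm]; exact H j i h
    · rw [gcls₃_eq_zero K (pair_self_mem j)]; exact zero_mem _
  have hjj : gcls₃ K i j j ∈ Submodule.span (ZMod 2) (Set.range (tripleVec K)) := by
    by_cases h : ({i, j} : Finset (Fin m)) ∈ K
    · rw [gcls₃_eq_zero K h]; exact zero_mem _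
    · exact Submodule.subset_span ⟨Sum.inl ⟨(i, j), hij, h⟩, rfl⟩
  rcases lt_trichotomy k i with h | rfl | h
  · exact (gcls₃_mem_span_of_lt K h hij).2.1
  · rwa [gcls₃_left_eq_right]
  · rcases lt_trichotomy k j with h' | rfl | h'
    · exact (gcls₃_mem_span_of_lt K h h').1
    · exact hjj
    · exact (gcls₃_mem_span_of_lt K hij h').2.2

theorem span_tripleVec : ⊤ ≤ Submodule.span (ZMod 2) (Set.range (tripleVec K)) := by
  have := addSubgroup_eq_top_of_gcls₃ K
    (Submodule.span (ZMod 2) (Set.range (tripleVec K))).toAddSubgroup (gcls₃_mem_span K)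
  exact fun x _ => (AddSubgroup.eq_top_iff' _).1 this x

end Spanning

/-! ### Linear independence -/

section Independence

variable {m : ℕ} (K : AbstractSimplicialComplex (Fin m))

theorem linearIndependent_of_functionals {ι V : Type*} [AddCommGroup V] [Module (ZMod 2) V]
    (v : ι → V) (h : ∀ s, ∃ f : V →+ ZMod 2, f (v s) = 1 ∧ ∀ t, t ≠ s → f (v t) = 0) :
    LinearIndependent (ZMod 2) v := by
  choose f hf hf' using h
  exact LinearIndependent.of_pairwise_dual_eq_zero_one v (fun s => (f s).toZModLinearMap 2)
    (fun s t hst => hf' s t hst.symm) hf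

/-- If `{p, q}` and `{q, r}` are not edges of `K`, then `g_p`, `g_q`, `g_r` can be sent to the three
elementary matrices on the first superdiagonal, and the other generators to `1`, because only the
neighbouring elementary matrices do not commute. The case `p = r` is allowed. -/
def uniTriHom (p q r : Fin m) (hpq : ({p, q} : Finset (Fin m)) ∉ K)
    (hqr : ({q, r} : Finset (Fin m)) ∉ K) : RC K →* UniTri (ZMod 2) :=
  rcLift (fun v => ⟨if v = p then 1 else 0, if v = q then 1 else 0, if v = r then 1 else 0,
    0, 0, 0⟩)
    (fun v => by
      have h₁ : p ≠ q := fun h => hpq (h ▸ pair_self_mem p)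
      have h₂ : q ≠ r := fun h => hqr (h ▸ pair_self_mem q)
      have h0 : (1 : ZMod 2) + 1 = 0 := rfl
      ext <;> simp <;> grind)
    (fun v w hvw => by
      have h₁ : ¬ (v = p ∧ w = q) := by rintro ⟨rfl, rfl⟩; exact hpq hvw
      have h₂ : ¬ (v = q ∧ w = r) := by rintro ⟨rfl, rfl⟩; exact hqr hvw
      rw [Finset.pair_comm] at hvw
      have h₃ : ¬ (w = p ∧ v = q) := by rintro ⟨rfl, rfl⟩; exact hpq hvw
      have h₄ : ¬ (w = q ∧ v = r) := by rintro ⟨rfl, rfl⟩; exact hqr hvw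
      ext <;> simp [comm] <;> grind)

theorem linearIndependent_gcls : LinearIndependent (ZMod 2) (gcls K) := by
  refine linearIndependent_of_functionals _ fun i => ?_
  let φ : RC K →* Multiplicative (ZMod 2) :=
    rcLift (fun v => Multiplicative.ofAdd (if v = i then 1 else 0))
      (fun v => by
        split_ifs
        · rfl
        · rfl)
      (fun v w _ => by simp [comm])
  refine ⟨compLift 1 (fun x => Multiplicative.toAdd (φ x))
    (fun x _ y _ => by rw [map_mul, toAdd_mul]) (fun x hx => ?_), ?_, fun j hj => ?_⟩
  · have : gam (RC K) (1 + 1) ≤ φ.ker := by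
      rw [gam_succ, Subgroup.commutator_le]
      intro a _ b _
      simp [MonoidHom.mem_ker, commutatorElement_def]
    rw [MonoidHom.mem_ker.1 (this hx), toAdd_one]
  · refine (compLift_cls (k := 1) _ _ _).trans ?_
    rw [rcLift_g]
    simp
  · refine (compLift_cls (k := 1) _ _ _).trans ?_
    rw [rcLift_g]
    simp [hj]

theorem linearIndependent_pairVec : LinearIndependent (ZMod 2) (pairVec K) := by
  refine linearIndependent_of_functionals _ fun ⟨(i, j), hij, h⟩ => ?_
  let φ := uniTriHom K i j i h (by rwa [Finset.pair_comm])
  have hφ (a b : Fin m) : (φ (comm (g K a) (g K b))).x₁₃ =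
      (if a = i then 1 else 0) * (if b = j then 1 else 0) -
        (if b = i then 1 else 0) * (if a = j then 1 else 0) := by
    rw [map_comm, UniTri.comm_x₁₃]
    simp only [φ, uniTriHom, rcLift_g]
  refine ⟨compLift 2 (fun x => (φ x).x₁₃) (fun x hx y _ => ?_) (fun x hx => ?_), ?_, ?_⟩
  · obtain ⟨h₁, -, -⟩ := UniTri.gam_two_le (map_mem_gam φ hx)
    rw [map_mul, UniTri.mul_x₁₃, h₁, zero_mul, add_zero]
  · exact (UniTri.gam_three_le (map_mem_gam φ hx)).2.2.2.1
  · refine (hφ i j).trans ?_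
    have : i ≠ j := hij.ne
    simp [this]
  · rintro ⟨⟨a, b⟩, hab, _⟩ hne
    refine (hφ a b).trans ?_
    have h₁ : ¬ (a = i ∧ b = j) := by rintro ⟨rfl, rfl⟩; exact hne rfl
    have h₂ : ¬ (b = i ∧ a = j) := by rintro ⟨rfl, rfl⟩; exact lt_asymm hij hab
    grind

/-- If `{i, j}` is not an edge of `K`, then some functional on `L^3(RC_K)` takes the value `1` on
`[ḡ_i, ḡ_j, ḡ_j]` and vanishes on all brackets which involve a third generator. It comes from the
projection of `RC_K` to the dihedral group of order `16`. -/
theorem exists_dihedral_functional {i j : Fin m} (h : ({i, j} : Finset (Fin m)) ∉ K) :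
    ∃ f : Comp (RC K) 3 →+ ZMod 2, f (gcls₃ K i j j) = 1 ∧
      ∀ a b c, ¬ ({a, b, c} : Finset (Fin m)) ⊆ {i, j} → f (gcls₃ K a b c) = 0 := by
  have hne : j ≠ i := by rintro rfl; exact h (pair_self_mem j)
  let s : Fin m → DihedralGroup 8 := fun v =>
    if v = i then .sr 0 else if v = j then .sr 1 else 1
  have si : s i = .sr 0 := if_pos rfl
  have sj : s j = .sr 1 := by simp [s, hne]
  have s1 {v : Fin m} (hi : v ≠ i) (hj : v ≠ j) : s v = 1 := by simp [s, hi, hj]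
  let φ : RC K →* DihedralGroup 8 := rcLift s
    (fun v => by simp only [s]; split_ifs <;> decide)
    (fun v w hvw => by
      by_cases hv : v = i
      · by_cases hw : w = j
        · subst hv hw; exact absurd hvw h
        · simp only [s, hv, hw, if_true, if_false]; split_ifs <;> decide
      · by_cases hw : w = i
        · by_cases hv' : v = j
          · subst hv' hw; exact absurd (Finset.pair_comm v w ▸ hvw) h
          · rw [s1 hv hv', comm_one_left]
        · simp only [s, hv, hw, if_false]; split_ifs <;> decide)
  have hφ (a b c : Fin m) : φ (comm (comm (g K a) (g K b)) (g K c)) =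
      comm (comm (s a) (s b)) (s c) := by
    simp only [map_comm, φ, rcLift_g]
  refine ⟨compLift 3 (fun x => rotFun (φ x)) (fun x hx y hy => ?_) (fun x hx => ?_), ?_, ?_⟩
  · rw [map_mul, rotFun_mul (map_mem_gam φ hx) (map_mem_gam φ hy)]
  · exact rotFun_eq_zero (map_mem_gam φ hx)
  · refine (compLift_cls (k := 3) _ _ _).trans ?_
    rw [hφ, si, sj]
    decide
  · intro a b c habc
    refine (compLift_cls (k := 3) _ _ _).trans ?_
    have hv : comm (comm (s a) (s b)) (s c) = 1 := by
      by_cases ha : a ∈ ({i, j} : Finset (Fin m))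
      · by_cases hb : b ∈ ({i, j} : Finset (Fin m))
        · by_cases hc : c ∈ ({i, j} : Finset (Fin m))
          · exact absurd (Finset.insert_subset ha (Finset.insert_subset hb
              (Finset.singleton_subset_iff.2 hc))) habc
          · rw [s1 (v := c) (by grind) (by grind), comm_one_right]
        · rw [s1 (v := b) (by grind) (by grind), comm_one_right, comm_one_left]
      · rw [s1 (v := a) (by grind) (by grind), comm_one_left, comm_one_left]
    rw [hφ, hv]
    rfl

/-- If `{p, q}` and `{q, r}` are not edges of `K`, then some functional on `L^3(RC_K)` is given on
brackets of generators by the `(1, 4)` entry of the corresponding iterated commutator of elementary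
matrices on the first superdiagonal. -/
theorem exists_uniTri_functional {p q r : Fin m} (hpq : ({p, q} : Finset (Fin m)) ∉ K)
    (hqr : ({q, r} : Finset (Fin m)) ∉ K) :
    ∃ f : Comp (RC K) 3 →+ ZMod 2, ∀ a b c, f (gcls₃ K a b c) =
      ((if a = p then 1 else 0) * (if b = q then 1 else 0) -
        (if b = p then 1 else 0) * (if a = q then 1 else 0)) * (if c = r then 1 else 0) -
      ((if a = q then 1 else 0) * (if b = r then 1 else 0) -
        (if b = q then 1 else 0) * (if a = r then 1 else 0)) * (if c = p then 1 else 0) := by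
  let φ := uniTriHom K p q r hpq hqr
  refine ⟨compLift 3 (fun x => (φ x).x₁₄) (fun x hx y _ => ?_) (fun x hx => ?_), ?_⟩
  · obtain ⟨h₁, -, -, h₄, -⟩ := UniTri.gam_three_le (map_mem_gam φ hx)
    rw [map_mul, UniTri.mul_x₁₄, h₁, h₄, zero_mul, zero_mul, add_zero, add_zero]
  · rw [Subgroup.mem_bot.1 (UniTri.gam_four_le (map_mem_gam φ hx)), UniTri.one_x₁₄]
  · intro a b c
    refine (compLift_cls (k := 3) _ _ _).trans ?_
    rw [map_comm, map_comm, UniTri.comm_comm_x₁₄]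
    simp only [φ, uniTriHom, rcLift_g]

theorem linearIndependent_tripleVec : LinearIndependent (ZMod 2) (tripleVec K) := by
  refine linearIndependent_of_functionals _ ?_
  rintro (⟨⟨i, j⟩, hij, h⟩ | ⟨⟨i, j, k⟩, hij, hkj, hik, hC⟩)
  · obtain ⟨f, hf, hf'⟩ := exists_dihedral_functional K h
    refine ⟨f, hf, ?_⟩
    rintro (⟨⟨a, b⟩, hab, _⟩ | ⟨⟨a, b, c⟩, hab, hcb, hac, _⟩) hne
    · refine hf' a b b fun hsub => hne ?_
      have ha : a = i ∨ a = j := by simpa using hsub (by simp : a ∈ _)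
      have hb : b = i ∨ b = j := by simpa using hsub (by simp : b ∈ _)
      have hab' : a < b := hab
      have hij' : i < j := hij
      obtain ⟨rfl, rfl⟩ : a = i ∧ b = j := by grind
      rfl
    · refine hf' a b c fun hsub => ?_
      have ha : a = i ∨ a = j := by simpa using hsub (by simp : a ∈ _)
      have hb : b = i ∨ b = j := by simpa using hsub (by simp : b ∈ _)
      have hc : c = i ∨ c = j := by simpa using hsub (by simp : c ∈ _)
      dsimp only at hab hcb hac
      grind
  · dsimp only at hij hkj hik hC
    obtain ⟨h₁, h₂⟩ := (exists_component_iff hij hkj).1 hC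
    by_cases hE : ({i, k} : Finset (Fin m)) ∈ K
    · -- Here `[ḡ_k, ḡ_j, ḡ_i]` is not listed, as `k` is not the smallest vertex of its component.
      obtain ⟨hle, hjk⟩ := h₂ hE
      obtain ⟨f, hf⟩ := exists_uniTri_functional K h₁ hjk
      refine ⟨f, (hf i j k).trans (by simp [hik, hij.ne]), ?_⟩
      rintro (⟨⟨a, b⟩, hab, _⟩ | ⟨⟨a, b, c⟩, hab, hcb, hac, hC'⟩) hne
      · refine (hf a b b).trans ?_
        grind
      · refine (hf a b c).trans ?_
        dsimp only at hab hcb hac hC'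
        have hn₁ : ¬ (a = i ∧ b = j ∧ c = k) := by rintro ⟨rfl, rfl, rfl⟩; exact hne rfl
        have hn₂ : ¬ (a = k ∧ b = j ∧ c = i) := by
          rintro ⟨rfl, rfl, rfl⟩
          exact hik (hle.antisymm
            (((exists_component_iff hab hcb).1 hC').2 (Finset.pair_comm a c ▸ hE)).1)
        grind
    · -- Placing `i` in the middle kills `[ḡ_k, ḡ_j, ḡ_i]`, whose first two entries commute.
      obtain ⟨f, hf⟩ := exists_uniTri_functional K (p := j) (q := i) (r := k)
        (by rwa [Finset.pair_comm]) hE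
      refine ⟨f, (hf i j k).trans ?_, ?_⟩
      · grind
      rintro (⟨⟨a, b⟩, hab, _⟩ | ⟨⟨a, b, c⟩, hab, hcb, hac, hC'⟩) hne
      · refine (hf a b b).trans ?_
        grind
      · refine (hf a b c).trans ?_
        dsimp only at hab hcb hac
        have hn₁ : ¬ (a = i ∧ b = j ∧ c = k) := by rintro ⟨rfl, rfl, rfl⟩; exact hne rfl
        grind

end Independence

end AssocLie

open AssocLie in
theorem theorem4p5 (m : ℕ) (K : AbstractSimplicialComplex (Fin m)) :
    (∃ b : Module.Basis (Fin m) (ZMod 2) (AssocLie.Comp (AssocLie.RC K) 1),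
      ∀ i, DirectSum.of (AssocLie.Comp (AssocLie.RC K)) 1 (b i) = AssocLie.gbar K i) ∧
    (∃ b : Module.Basis (AssocLie.Pairs K) (ZMod 2) (AssocLie.Comp (AssocLie.RC K) 2),
      ∀ p, DirectSum.of (AssocLie.Comp (AssocLie.RC K)) 2 (b p) =
        ⁅AssocLie.gbar K p.1.1, AssocLie.gbar K p.1.2⁆) ∧
    (∃ b : Module.Basis (AssocLie.Pairs K ⊕ AssocLie.Triples K) (ZMod 2)
        (AssocLie.Comp (AssocLie.RC K) 3),
      (∀ p : AssocLie.Pairs K, DirectSum.of (AssocLie.Comp (AssocLie.RC K)) 3 (b (Sum.inl p)) =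
        ⁅⁅AssocLie.gbar K p.1.1, AssocLie.gbar K p.1.2⁆, AssocLie.gbar K p.1.2⁆) ∧
      (∀ t : AssocLie.Triples K, DirectSum.of (AssocLie.Comp (AssocLie.RC K)) 3 (b (Sum.inr t)) =
        ⁅⁅AssocLie.gbar K t.1.1, AssocLie.gbar K t.1.2.1⁆, AssocLie.gbar K t.1.2.2⁆)) := by
  refine ⟨⟨.mk (linearIndependent_gcls K) (span_gcls K), fun i => ?_⟩,
    ⟨.mk (linearIndependent_pairVec K) (span_pairVec K), fun p => ?_⟩,
    ⟨.mk (linearIndependent_tripleVec K) (span_tripleVec K), fun p => ?_, fun t => ?_⟩⟩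
  · rw [Module.Basis.mk_apply, of_gcls]
  · rw [Module.Basis.mk_apply, pairVec, of_gcls₂]
  · rw [Module.Basis.mk_apply, tripleVec, of_gcls₃]
  · rw [Module.Basis.mk_apply, tripleVec, of_gcls₃]
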